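/- Let $n \ge 1$ and let $A^* \in \mathbb{R}_+^{n \times m}$ be a matrix with non-negative entries whose rows have unit $L_1$ norm, and let $B^* \in \mathbb{R}^{q \times p}$. Let $X_1, \dots, X_T \in \mathbb{R}^{m \times q}$ be fixed design matrices and suppose that one observes $$Y_t = A^* X_t B^* + E_t, \qquad t = 1, \dots, T,$$ where the noise matrices $E_1, \dots, E_T \in \mathbb{R}^{n \times p}$ are independent and matrix normal, $E_t \sim \mathcal{MN}_{n\times p}(0, \Sigma_r, \Sigma_c)$, i.e. $\mathrm{vec}(E_t) \sim \mathcal{N}_{np}(0, \Sigma_c \otimes \Sigma_r)$, with $\mathrm{vec}$ stacking columns. Let $\mathbb{X} \in \mathbb{R}^{T \times mq}$ and $\mathbb{Y} \in \mathbb{R}^{T \times np}$ be the matrices with rows $\mathrm{vec}(X_t)^\top$ and $\mathrm{vec}(Y_t)^\top$. Put $\widehat{\mathbb{C}} = (\mathbb{X}^\top \mathbb{X})^{-1} \mathbb{X}^\top \mathbb{Y} \in \mathbb{R}^{mq \times np}$, and let $[\widehat{\mathbb{C}}]_{(k,l),(i,j)}$ be its entry in the row that corresponds to the entry $(k,l)$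 of an $m \times q$ matrix and in the column that corresponds to the entry $(i,j)$ of an $n \times p$ matrix. Define the plug-in estimator $\hat B \in \mathbb{R}^{q \times p}$ by $$[\hat B]_{lj} = \frac1n \sum_{i=1}^n \sum_{k=1}^m [\widehat{\mathbb{C}}]_{(k,l),(i,j)} .$$ Assume that $\mathbb{X}^\top \mathbb{X} / T = I_{mq}$ and that $\Sigma_r = \sigma_r^2 I_n$, $\Sigma_c = \sigma_c^2 I_p$ with $\sigma_r, \sigma_c > 0$, and put $\sigma = \sigma_r \sigma_c$. Then for every $\epsilon > 0$ $$\mathbb{P}\left[ \| \hat B - B^* \|_{\max} > \epsilon \right] \le \frac{pq\sigma}{\epsilon} \sqrt{\frac{2m}{Tn\pi}} \exp\left( - \frac{Tn\epsilon^2}{2m\sigma^2} \right),$$ $$\mathbb{P}\left[ \| \hat B - B^* \|_F^2 > \epsilon \right] \le 2 \exp\left( - \frac{Tn\epsilon}{3m\sigma^2} + \frac{2pq}{3} \right),$$ and for every $\epsilon > 0$ with $\epsilon \ge (\sqrt p + \sqrt q)\, \sigma \sqrt{\frac{m}{nT}}$ $$\mathbb{P}\left[ \| \hat B - B^* \|_{\mathrm{op}}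 > \epsilon \right] \le 2 \exp\left( - \left( \frac{\epsilon \sqrt{nT}}{2\sigma\sqrt m} - \frac{\sqrt p + \sqrt q}{2} \right)^2 \right).$$ Here $\|\cdot\|_{\max}$ is the largest absolute value of an entry, $\|\cdot\|_{\mathrm{op}}$ is the operator norm with respect to the Euclidean norms, and $\|\cdot\|_F$ is the Frobenius norm. -/

import Mathlib

open MeasureTheory ProbabilityTheory
open scoped Matrix Kronecker

noncomputable section

/-- The max norm of a real matrix: the largest absolute value of an entry. -/
def maxNorm {q p : ℕ} (M : Matrix (Fin q) (Fin p) ℝ) : ℝ :=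
  ⨆ lj : Fin q × Fin p, |M lj.1 lj.2|

open scoped Matrix.Norms.L2Operator in
/-- The operator norm of a real matrix with respect to the Euclidean norms. -/
def opNorm {q p : ℕ} (M : Matrix (Fin q) (Fin p) ℝ) : ℝ := ‖M‖

open scoped Matrix.Norms.Frobenius in
/-- The Frobenius norm of a real matrix. -/
def frobNorm {q p : ℕ} (M : Matrix (Fin q) (Fin p) ℝ) : ℝ := ‖M‖

/-- The random matrix `E` has the matrix normal distribution with mean `M`, row covariance `U`
and column covariance `V`, that is, `vec E` (columns stacked) is Gaussian with mean `vec M` and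
covariance matrix `V ⊗ U`. The coordinates of `vec E` are indexed by (column, row). -/
def IsMatrixNormal {Ω : Type*} [MeasurableSpace Ω] {n p : ℕ}
    (E : Ω → Matrix (Fin n) (Fin p) ℝ) (M : Matrix (Fin n) (Fin p) ℝ)
    (U : Matrix (Fin n) (Fin n) ℝ) (V : Matrix (Fin p) (Fin p) ℝ) (P : Measure Ω) : Prop :=
  HasLaw (fun ω => WithLp.toLp 2 (Matrix.vec (E ω)))
    (multivariateGaussian (WithLp.toLp 2 (Matrix.vec M)) (V ⊗ₖ U)) P

/-- The `T × (ab)` matrix whose `t`-th row is `vec (Z t)`. Its columns are indexed by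
pairs (column of `Z t`, row of `Z t`). -/
def stackVec {T a b : ℕ} (Z : Fin T → Matrix (Fin a) (Fin b) ℝ) :
    Matrix (Fin T) (Fin b × Fin a) ℝ :=
  Matrix.of fun t => Matrix.vec (Z t)

/-- The least squares matrix `(𝕏ᵀ 𝕏)⁻¹ 𝕏ᵀ 𝕐`. -/
def cHat {T n p m q : ℕ} (X : Fin T → Matrix (Fin m) (Fin q) ℝ)
    (Y : Fin T → Matrix (Fin n) (Fin p) ℝ) : Matrix (Fin q × Fin m) (Fin p × Fin n) ℝ :=
  ((stackVec X)ᵀ * stackVec X)⁻¹ * (stackVec X)ᵀ * stackVec Y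

/-- The plug-in estimator `B̂`, with entries
`B̂ l j = (1 / n) ∑ i, ∑ k, Ĉ_{(k, l), (i, j)}`. -/
def bHat {T n p m q : ℕ} (X : Fin T → Matrix (Fin m) (Fin q) ℝ)
    (Y : Fin T → Matrix (Fin n) (Fin p) ℝ) : Matrix (Fin q) (Fin p) ℝ :=
  Matrix.of fun l j => (1 / (n : ℝ)) * ∑ i : Fin n, ∑ k : Fin m, cHat X Y (l, k) (j, i)

end

/-! Under the orthonormal design the least squares matrix is `B ⊗ₖ Aᵀ` plus a linear image of the
noise. The rows of `A` are non-negative with unit `L₁` norm, so they sum to 1 and the averaging in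
`bHat` returns `B` plus a linear form in the noise. The columns of the stacked design are
orthogonal, so the entries of the error are independent `N(0, s²)` with `s² = σ² m / (n T)`
(`map_bHat_sub_eq_gaussPi`). What remains are three tail bounds for a standard Gaussian `q × p`
matrix `G`.

Max norm: a union bound over the `q p` entries and Mills' bound. Frobenius norm: Chernoff's bound
for a chi-square variable.

Operator norm: on unit vectors, `uᵀ G v + γ` with an independent standard Gaussian `γ` is compared
with `⟨g, u⟩ + ⟨h, v⟩`, where `g`, `h` are independent standard Gaussian vectors. Both have variance
2, and their covariances differ by `(1 - ⟨u, u'⟩)(1 - ⟨v, v'⟩) ≥ 0`, so by `slepian` the second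
maximum is stochastically larger. It is at most `‖g‖ + ‖h‖`, which exceeds `√p + √q + t` with
probability at most `exp (-t² / 4)`. Since `γ ≥ 0` with probability at least 1/2, removing `γ` costs
a factor 2.

Slepian's inequality is proved by rotating one family of linear forms into the other and
differentiating the expectation of a smooth proxy for the event that all forms stay below `τ`;
Gaussian integration by parts gives the sign of the derivative. -/

/-- The law of a family of independent standard Gaussian variables. -/
noncomputable abbrev gaussPi (ι : Type*) [Fintype ι] : Measure (ι → ℝ) :=
  Measure.pi fun _ => gaussianReal 0 1

/-! ### Gaussian integration by parts -/

theorem integrable_id_mul_gaussianPDFReal :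
    Integrable fun x : ℝ => gaussianPDFReal 0 1 x * x := by
  have h : Integrable (fun x : ℝ => x) (gaussianReal 0 1) :=
    IsGaussian.integrable_fun_id
  rw [gaussianReal_of_var_ne_zero _ one_ne_zero,
    integrable_withDensity_iff_integrable_smul' (measurable_gaussianPDF _ _)
      (ae_of_all _ fun _ => gaussianPDF_lt_top)] at h
  simpa [toReal_gaussianPDF] using h

theorem hasDerivAt_gaussianPDFReal_std (x : ℝ) :
    HasDerivAt (gaussianPDFReal 0 1) (-(gaussianPDFReal 0 1 x * x)) x := by
  have h : HasDerivAt (fun x : ℝ => -(x - 0) ^ 2 / (2 * ((1 : NNReal) : ℝ))) (-x) x :=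
    (((hasDerivAt_id' x).sub_const 0).fun_pow 2).fun_neg.div_const (2 * ((1 : NNReal) : ℝ))
      |>.congr_deriv (by simp; ring)
  rw [gaussianPDFReal_def]
  exact ((h.exp).const_mul (√(2 * Real.pi * ((1 : NNReal) : ℝ)))⁻¹).congr_deriv (by ring)

/-- Gaussian integration by parts in one variable. -/
theorem integral_id_mul_gaussianReal {h h' : ℝ → ℝ} {C C' : ℝ}
    (hd : ∀ x, HasDerivAt h (h' x) x) (hb : ∀ x, |h x| ≤ C) (hb' : ∀ x, |h' x| ≤ C') :
    ∫ x, x * h x ∂gaussianReal 0 1 = ∫ x, h' x ∂gaussianReal 0 1 := by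
  have hc : Continuous h := continuous_iff_continuousAt.2 fun x => (hd x).continuousAt
  have hm' : Measurable h' := by
    rw [show h' = deriv h from funext fun x => (hd x).deriv.symm]
    exact measurable_deriv h
  have i1 : Integrable fun x : ℝ => h x * -(gaussianPDFReal 0 1 x * x) :=
    integrable_id_mul_gaussianPDFReal.neg.bdd_mul hc.aestronglyMeasurable
      (ae_of_all _ fun x => by simpa using hb x)
  have i2 : Integrable fun x : ℝ => h' x * gaussianPDFReal 0 1 x :=
    (integrable_gaussianPDFReal 0 1).bdd_mul hm'.aestronglyMeasurable
      (ae_of_all _ fun x => by simpa using hb' x)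
  have i3 : Integrable fun x : ℝ => h x * gaussianPDFReal 0 1 x :=
    (integrable_gaussianPDFReal 0 1).bdd_mul hc.aestronglyMeasurable
      (ae_of_all _ fun x => by simpa using hb x)
  have key := integral_mul_deriv_eq_deriv_mul_of_integrable (fun x _ => hd x)
    (fun x _ => hasDerivAt_gaussianPDFReal_std x) i1 i2 i3
  rw [integral_gaussianReal_eq_integral_smul one_ne_zero,
    integral_gaussianReal_eq_integral_smul one_ne_zero]
  simp only [smul_eq_mul]
  have e1 : ∫ x, gaussianPDFReal 0 1 x * (x * h x)
      = -∫ x, h x * -(gaussianPDFReal 0 1 x * x) := by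
    rw [← integral_neg]
    exact integral_congr_ae (ae_of_all _ fun x => by ring)
  rw [e1, key, neg_neg]
  exact integral_congr_ae (ae_of_all _ fun x => by ring)

/-- Resampling one coordinate independently does not change a product law. This lets Fubini isolate
the coordinate `i` without splitting the index type. -/
theorem measurePreserving_update_pi {ι : Type*} [Fintype ι] [DecidableEq ι] (ν : ι → Measure ℝ)
    [∀ i, IsProbabilityMeasure (ν i)] (i : ι) :
    MeasurePreserving (fun z : (ι → ℝ) × ℝ => Function.update z.1 i z.2)
      ((Measure.pi ν).prod (ν i)) (Measure.pi ν) := by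
  have hm : Measurable fun z : (ι → ℝ) × ℝ => Function.update z.1 i z.2 := by
    rw [measurable_pi_iff]
    intro j
    by_cases hj : j = i
    · subst hj
      simpa using measurable_snd
    · simpa [Function.update_of_ne hj] using by fun_prop
  refine ⟨hm, (Measure.pi_eq fun s hs => ?_).symm⟩
  rw [Measure.map_apply hm (.univ_pi hs)]
  -- The old coordinate `i` is overwritten, hence unconstrained; its factor has mass 1.
  have hpre : (fun z : (ι → ℝ) × ℝ => Function.update z.1 i z.2) ⁻¹' Set.univ.pi s
      = Set.univ.pi (Function.update s i Set.univ) ×ˢ s i := by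
    ext ⟨w, x⟩
    simp only [Set.mem_preimage, Set.mem_pi, Set.mem_univ, true_implies, Set.mem_prod]
    constructor
    · intro h
      refine ⟨fun j => ?_, by simpa using h i⟩
      by_cases hj : j = i
      · subst hj; simp
      · simpa [Function.update_of_ne hj] using h j
    · rintro ⟨h, hx⟩ j
      by_cases hj : j = i
      · subst hj; simpa using hx
      · simpa [Function.update_of_ne hj] using h j
  rw [hpre, Measure.prod_prod, Measure.pi_pi, ← Finset.prod_erase_mul _ _ (Finset.mem_univ i),
    ← Finset.prod_erase_mul Finset.univ (fun j => ν j (s j)) (Finset.mem_univ i)]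
  simp only [Function.update_self, measure_univ, mul_one]
  congr 1
  exact Finset.prod_congr rfl fun j hj => by rw [Function.update_of_ne (Finset.ne_of_mem_erase hj)]

theorem integrable_eval_gaussPi {ι : Type*} [Fintype ι] (i : ι) :
    Integrable (fun w : ι → ℝ => w i) (gaussPi ι) :=
  integrable_eval IsGaussian.integrable_id

/-- Gaussian integration by parts in one of several independent variables. -/
theorem integral_eval_mul_gaussPi {ι : Type*} [Fintype ι] [DecidableEq ι] (i : ι)
    {H H' : (ι → ℝ) → ℝ} {C C' : ℝ} (hH : Continuous H) (hH' : Continuous H')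
    (hd : ∀ w x, HasDerivAt (fun y => H (Function.update w i y)) (H' (Function.update w i x)) x)
    (hb : ∀ w, |H w| ≤ C) (hb' : ∀ w, |H' w| ≤ C') :
    ∫ w, w i * H w ∂gaussPi ι = ∫ w, H' w ∂gaussPi ι := by
  have mp : MeasurePreserving (fun z : (ι → ℝ) × ℝ => Function.update z.1 i z.2)
      ((gaussPi ι).prod (gaussianReal 0 1)) (gaussPi ι) :=
    measurePreserving_update_pi (fun _ : ι => gaussianReal 0 1) i
  have i1 : Integrable (fun w => w i * H w) (gaussPi ι) :=
    (integrable_eval_gaussPi i).mul_bdd hH.aestronglyMeasurable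
      (ae_of_all _ fun w => by simpa using hb w)
  have i2 : Integrable H' (gaussPi ι) :=
    (integrable_const C').mono' hH'.aestronglyMeasurable (ae_of_all _ fun w => by simpa using hb' w)
  have j1 := mp.integrable_comp_of_integrable i1
  have j2 := mp.integrable_comp_of_integrable i2
  rw [Function.comp_def] at j1 j2
  rw [← mp.map_eq, integral_map mp.aemeasurable (by rw [mp.map_eq]; exact i1.aestronglyMeasurable),
    integral_map mp.aemeasurable (by rw [mp.map_eq]; exact i2.aestronglyMeasurable),
    integral_prod _ j1, integral_prod _ j2]
  refine integral_congr_ae (ae_of_all _ fun w => ?_)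
  simp only [Function.update_self]
  exact integral_id_mul_gaussianReal (hd w) (fun _ => hb _) fun _ => hb' _

theorem hasDerivAt_dotProduct_update {ι : Type*} [Fintype ι] [DecidableEq ι] (a w : ι → ℝ) (i : ι)
    (x : ℝ) : HasDerivAt (fun y => a ⬝ᵥ Function.update w i y) (a i) x := by
  have h := hasDerivAt_pi.1 (hasDerivAt_update w i x)
  have := HasDerivAt.fun_sum (u := Finset.univ) fun j _ => (h j).const_mul (a j)
  exact this.congr_deriv (by simp [Pi.single_apply])

/-! ### A smooth proxy for the event that all forms stay below a level -/

/-- The exponential weight `exp (β (⟨a, w⟩ - τ))`. -/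
noncomputable def expWeight {ι : Type*} [Fintype ι] (β τ : ℝ) (a w : ι → ℝ) : ℝ :=
  Real.exp (β * (a ⬝ᵥ w - τ))

/-- The sum of the exponential weights of a family of linear forms: a soft count of the forms
that exceed `τ` at `w`. -/
noncomputable def expWeightSum {K ι : Type*} [Fintype K] [Fintype ι] (β τ : ℝ) (c : K → ι → ℝ)
    (w : ι → ℝ) : ℝ :=
  ∑ k, expWeight β τ (c k) w

section

variable {K ι : Type*} [Fintype K] [Fintype ι] (β τ : ℝ) (c : K → ι → ℝ)

theorem expWeight_pos (a w : ι → ℝ) : 0 < expWeight β τ a w := Real.exp_pos _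

theorem expWeightSum_nonneg (w : ι → ℝ) : 0 ≤ expWeightSum β τ c w :=
  Finset.sum_nonneg fun _ _ => (expWeight_pos ..).le

theorem expWeight_le_expWeightSum (k : K) (w : ι → ℝ) :
    expWeight β τ (c k) w ≤ expWeightSum β τ c w :=
  Finset.single_le_sum (f := fun k => expWeight β τ (c k) w)
    (fun _ _ => (expWeight_pos ..).le) (Finset.mem_univ k)

@[fun_prop]
theorem continuous_expWeight (a : ι → ℝ) : Continuous (expWeight β τ a) := by
  unfold expWeight dotProduct
  fun_prop

@[fun_prop]
theorem continuous_expWeightSum : Continuous (expWeightSum β τ c) := by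
  unfold expWeightSum
  fun_prop

/-- The weights are unbounded, but each is at most the sum `S`, and `S exp (-S) ≤ 1`. This bound and
its quadratic analogue, from `S² ≤ 2 exp S`, supply the boundedness that integration by parts and
dominated convergence require. -/
theorem abs_expWeight_mul_exp_neg_le (k : K) (w : ι → ℝ) :
    |expWeight β τ (c k) w * Real.exp (-expWeightSum β τ c w)| ≤ 1 := by
  have h1 := expWeight_pos β τ (c k) w
  rw [abs_of_pos (by positivity), Real.exp_neg, ← div_eq_mul_inv, div_le_one (Real.exp_pos _)]
  linarith [expWeight_le_expWeightSum β τ c k w, Real.add_one_le_exp (expWeightSum β τ c w)]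

theorem abs_expWeight_mul_expWeight_mul_exp_neg_le (k l : K) (w : ι → ℝ) :
    |expWeight β τ (c k) w * expWeight β τ (c l) w * Real.exp (-expWeightSum β τ c w)| ≤ 2 := by
  have h1 := expWeight_pos β τ (c k) w
  have h2 := expWeight_pos β τ (c l) w
  have h0 := expWeightSum_nonneg β τ c w
  rw [abs_of_pos (by positivity), Real.exp_neg, ← div_eq_mul_inv, div_le_iff₀ (Real.exp_pos _)]
  have := mul_le_mul (expWeight_le_expWeightSum β τ c k w) (expWeight_le_expWeightSum β τ c l w)
    h2.le h0
  nlinarith [Real.quadratic_le_exp_of_nonneg h0]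

theorem integrable_expWeight_mul_exp_neg (k : K) :
    Integrable (fun w => expWeight β τ (c k) w * Real.exp (-expWeightSum β τ c w)) (gaussPi ι) :=
  (integrable_const (1 : ℝ)).mono' (by fun_prop)
    (ae_of_all _ fun w => by simpa using abs_expWeight_mul_exp_neg_le β τ c k w)

theorem integrable_expWeight_mul_expWeight_mul_exp_neg (k l : K) :
    Integrable (fun w => expWeight β τ (c k) w * expWeight β τ (c l) w *
      Real.exp (-expWeightSum β τ c w)) (gaussPi ι) :=
  (integrable_const (2 : ℝ)).mono' (by fun_prop)
    (ae_of_all _ fun w => by simpa using abs_expWeight_mul_expWeight_mul_exp_neg_le β τ c k l w)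

theorem integral_eval_mul_expWeight_mul_exp_neg (k : K) (i : ι) :
    ∫ w, w i * (expWeight β τ (c k) w * Real.exp (-expWeightSum β τ c w)) ∂gaussPi ι
      = β * (c k i * ∫ w, expWeight β τ (c k) w * Real.exp (-expWeightSum β τ c w) ∂gaussPi ι
        - ∑ l, c l i * ∫ w, expWeight β τ (c k) w * expWeight β τ (c l) w *
          Real.exp (-expWeightSum β τ c w) ∂gaussPi ι) := by
  classical
  have hd : ∀ a w x, HasDerivAt (fun y => expWeight β τ a (Function.update w i y))
      (β * a i * expWeight β τ a (Function.update w i x)) x := fun a w x =>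
    (((hasDerivAt_dotProduct_update a w i x).sub_const τ).const_mul β).exp.congr_deriv
      (by rw [expWeight]; ring)
  have hS : ∀ w x, HasDerivAt (fun y => expWeightSum β τ c (Function.update w i y))
      (∑ l, β * c l i * expWeight β τ (c l) (Function.update w i x)) x := fun w x =>
    HasDerivAt.fun_sum fun l _ => hd (c l) w x
  rw [integral_eval_mul_gaussPi (C := 1) (C' := |β| * (|c k i| * 1 + ∑ l, |c l i| * 2))
    (H' := fun w => β * (c k i * (expWeight β τ (c k) w * Real.exp (-expWeightSum β τ c w))
        - ∑ l, c l i * (expWeight β τ (c k) w * expWeight β τ (c l) w *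
          Real.exp (-expWeightSum β τ c w)))) i (by fun_prop) (by fun_prop)]
  · rw [integral_const_mul, integral_sub, integral_const_mul, integral_finsetSum]
    · simp_rw [integral_const_mul]
    · exact fun l _ => (integrable_expWeight_mul_expWeight_mul_exp_neg β τ c k l).const_mul _
    · exact (integrable_expWeight_mul_exp_neg β τ c k).const_mul _
    · exact integrable_finsetSum _ fun l _ =>
        (integrable_expWeight_mul_expWeight_mul_exp_neg β τ c k l).const_mul _
  · intro w x
    refine ((hd (c k) w x).mul (hS w x).fun_neg.exp).congr_deriv ?_
    simp only [mul_sub, Finset.mul_sum, mul_neg, ← Finset.sum_neg_distrib]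
    rw [sub_eq_add_neg, ← Finset.sum_neg_distrib]
    congr 1
    · ring
    · exact Finset.sum_congr rfl fun l _ => by ring
  · exact abs_expWeight_mul_exp_neg_le β τ c k
  · intro w
    rw [abs_mul]
    refine mul_le_mul_of_nonneg_left ((abs_sub _ _).trans (add_le_add ?_ ?_)) (abs_nonneg _)
    · rw [abs_mul]
      exact mul_le_mul_of_nonneg_left (abs_expWeight_mul_exp_neg_le β τ c k w) (abs_nonneg _)
    · refine (Finset.abs_sum_le_sum_abs _ _).trans (Finset.sum_le_sum fun l _ => ?_)
      rw [abs_mul]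
      exact mul_le_mul_of_nonneg_left
        (abs_expWeight_mul_expWeight_mul_exp_neg_le β τ c k l w) (abs_nonneg _)

/-- Integration by parts turns the factor `d ⬝ᵥ w` into the covariances of `d` with the forms `c l`;
only these signs matter later. -/
theorem integral_dotProduct_mul_expWeight_mul_exp_neg (k : K) (d : ι → ℝ) :
    ∫ w, d ⬝ᵥ w * (expWeight β τ (c k) w * Real.exp (-expWeightSum β τ c w)) ∂gaussPi ι
      = β * (d ⬝ᵥ c k * ∫ w, expWeight β τ (c k) w * Real.exp (-expWeightSum β τ c w) ∂gaussPi ι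
        - ∑ l, d ⬝ᵥ c l * ∫ w, expWeight β τ (c k) w * expWeight β τ (c l) w *
          Real.exp (-expWeightSum β τ c w) ∂gaussPi ι) := by
  have hi : ∀ i, Integrable (fun w : ι → ℝ => w i * (expWeight β τ (c k) w *
      Real.exp (-expWeightSum β τ c w))) (gaussPi ι) := fun i =>
    (integrable_eval_gaussPi i).mul_bdd (c := 1) (by fun_prop)
      (ae_of_all _ fun w => by simpa using abs_expWeight_mul_exp_neg_le β τ c k w)
  have e : ∀ w : ι → ℝ, d ⬝ᵥ w * (expWeight β τ (c k) w * Real.exp (-expWeightSum β τ c w))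
      = ∑ i, d i * (w i * (expWeight β τ (c k) w * Real.exp (-expWeightSum β τ c w))) := fun w => by
    rw [dotProduct, Finset.sum_mul]
    exact Finset.sum_congr rfl fun i _ => by ring
  simp_rw [e]
  rw [integral_finsetSum _ fun i _ => (hi i).const_mul _]
  simp_rw [integral_const_mul, integral_eval_mul_expWeight_mul_exp_neg, dotProduct, mul_sub,
    Finset.sum_sub_distrib, Finset.mul_sum, Finset.sum_mul, Finset.mul_sum]
  rw [Finset.sum_comm (s := Finset.univ (α := ι)) (t := Finset.univ (α := K))]
  congr 1
  · exact Finset.sum_congr rfl fun i _ => by ring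
  · exact Finset.sum_congr rfl fun i _ => Finset.sum_congr rfl fun i _ => by ring

end

/-! ### Interpolation by rotation and Slepian's inequality -/

section

variable {K ι : Type*} [Fintype ι]

/-- The point at angle `θ` of the quarter circle from the family `a` to the family `b`. -/
noncomputable def rotate (a b : K → ι → ℝ) (θ : ℝ) (k : K) : ι → ℝ :=
  Real.cos θ • a k + Real.sin θ • b k

/-- The derivative of `rotate a b` in the angle. -/
noncomputable def rotateDeriv (a b : K → ι → ℝ) (θ : ℝ) (k : K) : ι → ℝ :=
  -Real.sin θ • a k + Real.cos θ • b k

theorem hasDerivAt_rotate_dotProduct (a b : K → ι → ℝ) (k : K) (w : ι → ℝ) (θ : ℝ) :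
    HasDerivAt (fun θ => rotate a b θ k ⬝ᵥ w) (rotateDeriv a b θ k ⬝ᵥ w) θ := by
  simp only [rotate, rotateDeriv, add_dotProduct, smul_dotProduct, smul_eq_mul]
  exact ((Real.hasDerivAt_cos θ).mul_const _).add ((Real.hasDerivAt_sin θ).mul_const _)

theorem abs_rotateDeriv_dotProduct_le (a b : K → ι → ℝ) (k : K) (w : ι → ℝ) (θ : ℝ) :
    |rotateDeriv a b θ k ⬝ᵥ w| ≤ |a k ⬝ᵥ w| + |b k ⬝ᵥ w| := by
  simp only [rotateDeriv, add_dotProduct, smul_dotProduct, smul_eq_mul]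
  refine (abs_add_le _ _).trans (add_le_add ?_ ?_) <;> rw [abs_mul]
  · rw [abs_neg]
    exact mul_le_of_le_one_left (abs_nonneg _) (Real.abs_sin_le_one θ)
  · exact mul_le_of_le_one_left (abs_nonneg _) (Real.abs_cos_le_one θ)

theorem integrable_dotProduct_gaussPi (a : ι → ℝ) : Integrable (fun w => a ⬝ᵥ w) (gaussPi ι) :=
  integrable_finsetSum _ fun i _ => (integrable_eval_gaussPi i).const_mul (a i)

@[fun_prop]
theorem continuous_const_dotProduct (a : ι → ℝ) : Continuous fun w => a ⬝ᵥ w := by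
  unfold dotProduct
  fun_prop

theorem hasDerivAt_integral_exp_neg_expWeightSum [Fintype K] (β τ : ℝ) (a b : K → ι → ℝ) (θ : ℝ) :
    HasDerivAt (fun θ => ∫ w, Real.exp (-expWeightSum β τ (rotate a b θ) w) ∂gaussPi ι)
      (-β * ∑ k, ∫ w, rotateDeriv a b θ k ⬝ᵥ w * (expWeight β τ (rotate a b θ k) w *
        Real.exp (-expWeightSum β τ (rotate a b θ) w)) ∂gaussPi ι) θ := by
  have hmul : ∀ k θ, Integrable (fun w => rotateDeriv a b θ k ⬝ᵥ w *
      (expWeight β τ (rotate a b θ k) w * Real.exp (-expWeightSum β τ (rotate a b θ) w)))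
      (gaussPi ι) := fun k θ =>
    (integrable_dotProduct_gaussPi _).mul_bdd (c := 1) (by fun_prop)
      (ae_of_all _ fun w => by simpa using abs_expWeight_mul_exp_neg_le β τ (rotate a b θ) k w)
  rw [← integral_finsetSum _ fun k _ => hmul k θ, ← integral_const_mul]
  refine (hasDerivAt_integral_of_dominated_loc_of_deriv_le (s := Set.univ)
    (bound := fun w => |β| * ∑ k, (|a k ⬝ᵥ w| + |b k ⬝ᵥ w|))
    (F' := fun θ w => -β * ∑ k, rotateDeriv a b θ k ⬝ᵥ w * (expWeight β τ (rotate a b θ k) w *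
        Real.exp (-expWeightSum β τ (rotate a b θ) w)))
    Filter.univ_mem ?_ ?_ ?_ ?_ ?_ ?_).2
  · exact Filter.Eventually.of_forall fun θ => by fun_prop
  · exact (integrable_const (1 : ℝ)).mono' (by fun_prop) (ae_of_all _ fun w => by
      simpa using expWeightSum_nonneg β τ _ w)
  · fun_prop
  · refine ae_of_all _ fun w θ _ => ?_
    rw [Real.norm_eq_abs, abs_mul, abs_neg]
    refine mul_le_mul_of_nonneg_left ((Finset.abs_sum_le_sum_abs _ _).trans
      (Finset.sum_le_sum fun k _ => ?_)) (abs_nonneg _)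
    rw [abs_mul]
    exact (mul_le_of_le_one_right (abs_nonneg _) (abs_expWeight_mul_exp_neg_le β τ _ k w)).trans
      (abs_rotateDeriv_dotProduct_le a b k w θ)
  · exact (integrable_finsetSum _ fun k _ => (integrable_dotProduct_gaussPi (a k)).abs.add
      (integrable_dotProduct_gaussPi (b k)).abs).const_mul _
  · refine ae_of_all _ fun w θ _ => ?_
    have h1 : ∀ k, HasDerivAt (fun θ => expWeight β τ (rotate a b θ k) w)
        (β * (rotateDeriv a b θ k ⬝ᵥ w) * expWeight β τ (rotate a b θ k) w) θ := fun k =>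
      (((hasDerivAt_rotate_dotProduct a b k w θ).sub_const τ).const_mul β).exp.congr_deriv
        (by rw [expWeight]; ring)
    have h2 : HasDerivAt (fun θ => expWeightSum β τ (rotate a b θ) w)
        (∑ k, β * (rotateDeriv a b θ k ⬝ᵥ w) * expWeight β τ (rotate a b θ k) w) θ :=
      HasDerivAt.fun_sum fun k _ => h1 k
    refine h2.fun_neg.exp.congr_deriv ?_
    rw [neg_mul, mul_neg, Finset.mul_sum, Finset.mul_sum]
    congr 1
    exact Finset.sum_congr rfl fun k _ => by ring

/-- Orthogonality removes the mixed terms, so along the rotation only the difference of the two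
covariance matrices is felt. -/
theorem rotateDeriv_dotProduct_rotate {a b : K → ι → ℝ} (hab : ∀ k l, a k ⬝ᵥ b l = 0) (θ : ℝ)
    (k l : K) : rotateDeriv a b θ k ⬝ᵥ rotate a b θ l
      = Real.sin θ * Real.cos θ * (b k ⬝ᵥ b l - a k ⬝ᵥ a l) := by
  simp only [rotateDeriv, rotate, add_dotProduct, dotProduct_add, smul_dotProduct, dotProduct_smul,
    smul_eq_mul, hab, dotProduct_comm (b k) (a l)]
  ring

/-- The comparison of Slepian for a product of smooth decreasing functions. -/
theorem integral_exp_neg_expWeightSum_le [Fintype K] {β : ℝ} (τ : ℝ) {a b : K → ι → ℝ}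
    (hab : ∀ k l, a k ⬝ᵥ b l = 0) (hdiag : ∀ k, b k ⬝ᵥ b k = a k ⬝ᵥ a k)
    (hoff : ∀ k l, b k ⬝ᵥ b l ≤ a k ⬝ᵥ a l) :
    ∫ w, Real.exp (-expWeightSum β τ b w) ∂gaussPi ι
      ≤ ∫ w, Real.exp (-expWeightSum β τ a w) ∂gaussPi ι := by
  set Φ : ℝ → ℝ := fun θ => ∫ w, Real.exp (-expWeightSum β τ (rotate a b θ) w) ∂gaussPi ι with hΦ
  have hd := hasDerivAt_integral_exp_neg_expWeightSum β τ a b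
  have anti : AntitoneOn Φ (Set.Icc 0 (Real.pi / 2)) := by
    refine antitoneOn_of_deriv_nonpos (convex_Icc _ _)
      (fun θ _ => (hd θ).continuousAt.continuousWithinAt)
      (fun θ _ => (hd θ).differentiableAt.differentiableWithinAt) fun θ hθ => ?_
    rw [interior_Icc] at hθ
    have hs : 0 ≤ Real.sin θ * Real.cos θ :=
      mul_nonneg (Real.sin_nonneg_of_nonneg_of_le_pi hθ.1.le (by linarith [hθ.2, Real.pi_pos]))
        (Real.cos_nonneg_of_neg_pi_div_two_le_of_le (by linarith [hθ.1, Real.pi_pos]) hθ.2.le)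
    rw [(hd θ).deriv]
    have hk : ∀ k, 0 ≤ β * ∫ w, rotateDeriv a b θ k ⬝ᵥ w * (expWeight β τ (rotate a b θ k) w *
        Real.exp (-expWeightSum β τ (rotate a b θ) w)) ∂gaussPi ι := fun k => by
      rw [integral_dotProduct_mul_expWeight_mul_exp_neg, ← mul_assoc]
      refine mul_nonneg (mul_self_nonneg β) ?_
      -- Equal variances cancel the term with a single weight; the products of two weights are
      -- positive, so the covariance differences decide the sign.
      rw [rotateDeriv_dotProduct_rotate hab, hdiag, sub_self, mul_zero, zero_mul, zero_sub,
        neg_nonneg]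
      refine Finset.sum_nonpos fun l _ => mul_nonpos_of_nonpos_of_nonneg ?_ ?_
      · rw [rotateDeriv_dotProduct_rotate hab]
        exact mul_nonpos_of_nonneg_of_nonpos hs (sub_nonpos.2 (hoff k l))
      · exact integral_nonneg fun w => mul_nonneg (mul_nonneg (expWeight_pos ..).le
          (expWeight_pos ..).le) (Real.exp_pos _).le
    rw [neg_mul, neg_nonpos, Finset.mul_sum]
    exact Finset.sum_nonneg fun k _ => hk k
  have h := anti (Set.left_mem_Icc.2 (by positivity)) (Set.right_mem_Icc.2 (by positivity))
    (by positivity : (0 : ℝ) ≤ Real.pi / 2)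
  have e0 : rotate a b 0 = a := by ext; simp [rotate]
  have e1 : rotate a b (Real.pi / 2) = b := by ext; simp [rotate]
  simpa only [hΦ, e0, e1] using h

theorem tendsto_expWeight_of_lt {τ : ℝ} {a w : ι → ℝ} (h : a ⬝ᵥ w < τ) :
    Filter.Tendsto (fun n : ℕ => expWeight n τ a w) Filter.atTop (nhds 0) := by
  refine Real.tendsto_exp_atBot.comp ?_
  exact tendsto_natCast_atTop_atTop.atTop_mul_const_of_neg (sub_neg.2 h)

theorem tendsto_expWeight_of_gt {τ : ℝ} {a w : ι → ℝ} (h : τ < a ⬝ᵥ w) :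
    Filter.Tendsto (fun n : ℕ => expWeight n τ a w) Filter.atTop Filter.atTop := by
  refine Real.tendsto_exp_atTop.comp ?_
  exact tendsto_natCast_atTop_atTop.atTop_mul_const (sub_pos.2 h)

/-- Slepian's inequality for linear images of a standard Gaussian vector. -/
theorem slepian_of_orthogonal [Fintype K] (τ : ℝ) {a b : K → ι → ℝ}
    (hab : ∀ k l, a k ⬝ᵥ b l = 0) (hdiag : ∀ k, b k ⬝ᵥ b k = a k ⬝ᵥ a k)
    (hoff : ∀ k l, b k ⬝ᵥ b l ≤ a k ⬝ᵥ a l) :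
    (gaussPi ι).real {w | ∃ k, τ < a k ⬝ᵥ w} ≤ (gaussPi ι).real {w | ∃ k, τ ≤ b k ⬝ᵥ w} := by
  have mA : MeasurableSet {w : ι → ℝ | ∃ k, τ < a k ⬝ᵥ w} := by
    simp only [Set.ofPred_exists]
    exact .iUnion fun k => measurableSet_lt measurable_const (by fun_prop)
  have mB : MeasurableSet {w : ι → ℝ | ∃ k, τ ≤ b k ⬝ᵥ w} := by
    simp only [Set.ofPred_exists]
    exact .iUnion fun k => measurableSet_le measurable_const (by fun_prop)
  have hint : ∀ (c : K → ι → ℝ) (β : ℝ), Integrable (fun w => Real.exp (-expWeightSum β τ c w))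
      (gaussPi ι) := fun c β =>
    (integrable_const (1 : ℝ)).mono' (by fun_prop) (ae_of_all _ fun w => by
      simpa using expWeightSum_nonneg β τ _ w)
  -- As `β = n` grows, the proxy tends to 0 where some form exceeds `τ` and to 1 where all are
  -- below. A form equal to `τ` keeps weight 1 for every `β`; hence the strict inequality for `a`
  -- and the weak one for `b`.
  have limA : Filter.Tendsto (fun n : ℕ => ∫ w in {w | ∃ k, τ < a k ⬝ᵥ w},
      Real.exp (-expWeightSum n τ a w) ∂gaussPi ι) Filter.atTop (nhds 0) := by
    rw [← integral_zero (ι → ℝ) ℝ (μ := (gaussPi ι).restrict {w | ∃ k, τ < a k ⬝ᵥ w})]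
    refine tendsto_integral_of_dominated_convergence (fun _ => 1) (fun n => by fun_prop)
      (integrable_const _) (fun n => ae_of_all _ fun w => by
        simpa using expWeightSum_nonneg n τ _ w) ?_
    refine (ae_restrict_mem mA).mono fun w hw => ?_
    obtain ⟨k, hk⟩ := hw
    refine Real.tendsto_exp_neg_atTop_nhds_zero.comp ?_
    exact Filter.tendsto_atTop_mono (fun n => expWeight_le_expWeightSum n τ a k w)
      (tendsto_expWeight_of_gt hk)
  have limB : Filter.Tendsto (fun n : ℕ => ∫ w in {w | ∃ k, τ ≤ b k ⬝ᵥ w}ᶜ,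
      Real.exp (-expWeightSum n τ b w) ∂gaussPi ι) Filter.atTop
      (nhds ((gaussPi ι).real {w | ∃ k, τ ≤ b k ⬝ᵥ w}ᶜ)) := by
    have : (gaussPi ι).real {w | ∃ k, τ ≤ b k ⬝ᵥ w}ᶜ
        = ∫ w in {w | ∃ k, τ ≤ b k ⬝ᵥ w}ᶜ, (1 : ℝ) ∂gaussPi ι := by simp
    rw [this]
    refine tendsto_integral_of_dominated_convergence (fun _ => 1) (fun n => by fun_prop)
      (integrable_const _) (fun n => ae_of_all _ fun w => by
        simpa using expWeightSum_nonneg n τ _ w) ?_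
    refine (ae_restrict_mem mB.compl).mono fun w hw => ?_
    have hw' : ∀ k, b k ⬝ᵥ w < τ := by simpa using hw
    have h0 := tendsto_finsetSum Finset.univ fun k _ => tendsto_expWeight_of_lt (hw' k)
    rw [Finset.sum_const_zero] at h0
    simpa [Function.comp_def, expWeightSum] using (Real.continuous_exp.tendsto _).comp h0.neg
  have key : ∀ n : ℕ, ∫ w in {w | ∃ k, τ ≤ b k ⬝ᵥ w}ᶜ, Real.exp (-expWeightSum n τ b w) ∂gaussPi ι
      ≤ ∫ w in {w | ∃ k, τ < a k ⬝ᵥ w}, Real.exp (-expWeightSum n τ a w) ∂gaussPi ι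
        + (gaussPi ι).real {w | ∃ k, τ < a k ⬝ᵥ w}ᶜ := fun n => by
    refine (setIntegral_le_integral (hint b n)
      (ae_of_all _ fun w => (Real.exp_pos _).le)).trans
      ((integral_exp_neg_expWeightSum_le τ hab hdiag hoff).trans ?_)
    rw [← integral_add_compl mA (hint a n)]
    gcongr
    refine (setIntegral_mono_on (hint a n).integrableOn (integrable_const (1 : ℝ)).integrableOn
      mA.compl fun w _ => ?_).trans (by simp)
    simpa using expWeightSum_nonneg n τ _ w
  have := le_of_tendsto_of_tendsto' limB (limA.add_const _) key
  rw [zero_add, probReal_compl_eq_one_sub mA, probReal_compl_eq_one_sub mB] at this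
  linarith

end

/-- Slepian's inequality: if two families of linear forms in standard Gaussian vectors have the
same variances and the second has the smaller covariances, then the maximum of the second is
stochastically larger. -/
theorem slepian {K I J : Type*} [Fintype K] [Fintype I] [Fintype J] (τ : ℝ)
    {a : K → I → ℝ} {b : K → J → ℝ} (hdiag : ∀ k, b k ⬝ᵥ b k = a k ⬝ᵥ a k)
    (hoff : ∀ k l, b k ⬝ᵥ b l ≤ a k ⬝ᵥ a l) :
    (gaussPi I).real {w | ∃ k, τ < a k ⬝ᵥ w} ≤ (gaussPi J).real {w | ∃ k, τ ≤ b k ⬝ᵥ w} := by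
  -- Disjoint blocks of coordinates make the two families orthogonal, that is, independent.
  have h := slepian_of_orthogonal (ι := I ⊕ J) τ (a := fun k => Sum.elim (a k) 0)
    (b := fun k => Sum.elim 0 (b k)) (by simp) (by simpa using hdiag) (by simpa using hoff)
  have mp := measurePreserving_sumPiEquivProdPi (fun _ : I ⊕ J => gaussianReal 0 1)
  have m1 : MeasurePreserving (fun w : I ⊕ J → ℝ => w ∘ Sum.inl) (gaussPi (I ⊕ J)) (gaussPi I) :=
    measurePreserving_fst.comp mp
  have m2 : MeasurePreserving (fun w : I ⊕ J → ℝ => w ∘ Sum.inr) (gaussPi (I ⊕ J)) (gaussPi J) :=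
    measurePreserving_snd.comp mp
  have mA : MeasurableSet {w : I → ℝ | ∃ k, τ < a k ⬝ᵥ w} := by
    simp only [Set.ofPred_exists]
    exact .iUnion fun k => measurableSet_lt measurable_const (by fun_prop)
  have mB : MeasurableSet {w : J → ℝ | ∃ k, τ ≤ b k ⬝ᵥ w} := by
    simp only [Set.ofPred_exists]
    exact .iUnion fun k => measurableSet_le measurable_const (by fun_prop)
  rw [← m1.measureReal_preimage mA.nullMeasurableSet,
    ← m2.measureReal_preimage mB.nullMeasurableSet]
  have hl : ∀ (u : I → ℝ) (w : I ⊕ J → ℝ), Sum.elim u 0 ⬝ᵥ w = u ⬝ᵥ (w ∘ Sum.inl) := fun u w => by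
    simp [dotProduct]
  have hr : ∀ (u : J → ℝ) (w : I ⊕ J → ℝ), Sum.elim 0 u ⬝ᵥ w = u ⬝ᵥ (w ∘ Sum.inr) := fun u w => by
    simp [dotProduct]
  simpa only [hl, hr, Set.preimage_ofPred_eq] using h

/-! ### Chernoff bounds for squares and norms of Gaussian vectors -/

/-- For `μ ≥ 1 / 2` the integral diverges and both sides take the default value 0. For `μ < 1 / 2`
the value is nonzero, which in turn yields integrability. -/
theorem integral_exp_mul_sq_gaussianReal (μ : ℝ) :
    ∫ x, Real.exp (μ * x ^ 2) ∂gaussianReal 0 1 = (√(1 - 2 * μ))⁻¹ := by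
  rw [integral_gaussianReal_eq_integral_smul one_ne_zero, gaussianPDFReal_def]
  have e : ∀ x : ℝ, ((√(2 * Real.pi * ((1 : NNReal) : ℝ)))⁻¹ *
      Real.exp (-(x - 0) ^ 2 / (2 * ((1 : NNReal) : ℝ)))) • Real.exp (μ * x ^ 2)
      = (√(2 * Real.pi))⁻¹ * Real.exp (-(1 / 2 - μ) * x ^ 2) := fun x => by
    rw [smul_eq_mul, mul_assoc, ← Real.exp_add, NNReal.coe_one, mul_one]
    congr 2
    ring
  simp_rw [e]
  rw [integral_const_mul, integral_gaussian, ← Real.sqrt_inv, ← Real.sqrt_inv, ← Real.sqrt_mul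
    (by positivity)]
  congr 1
  have hp := Real.pi_pos.ne'
  rw [show 1 - 2 * μ = 2 * (1 / 2 - μ) by ring]
  field_simp

theorem integrable_exp_mul_sq_gaussianReal {μ : ℝ} (hμ : μ < 1 / 2) :
    Integrable (fun x => Real.exp (μ * x ^ 2)) (gaussianReal 0 1) := by
  refine Integrable.of_integral_ne_zero ?_
  rw [integral_exp_mul_sq_gaussianReal]
  exact inv_ne_zero (Real.sqrt_ne_zero'.2 (by linarith))

/-- Chernoff's bound for a weighted sum of squares of independent standard Gaussian variables. -/
theorem gaussPi_real_le_sum_mul_sq {ι : Type*} [Fintype ι] {μ : ι → ℝ} (hμ : ∀ i, μ i < 1 / 2)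
    (x : ℝ) : (gaussPi ι).real {w | x ≤ ∑ i, μ i * w i ^ 2}
      ≤ Real.exp (-x) * ∏ i, (√(1 - 2 * μ i))⁻¹ := by
  have e : ∀ w : ι → ℝ, Real.exp (1 * ∑ i, μ i * w i ^ 2) = ∏ i, Real.exp (μ i * w i ^ 2) :=
    fun w => by rw [one_mul, Real.exp_sum]
  have hi : Integrable (fun w : ι → ℝ => Real.exp (1 * ∑ i, μ i * w i ^ 2)) (gaussPi ι) := by
    simp_rw [e]
    exact Integrable.fintype_prod (f := fun i x => Real.exp (μ i * x ^ 2))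
      fun i => integrable_exp_mul_sq_gaussianReal (hμ i)
  refine (measure_ge_le_exp_mul_mgf x zero_le_one hi).trans_eq ?_
  rw [mgf, neg_one_mul]
  simp_rw [e]
  rw [integral_fintype_prod_eq_prod (f := fun i x => Real.exp (μ i * x ^ 2))]
  simp_rw [integral_exp_mul_sq_gaussianReal]

/-- Chernoff's bound with exponent 1/3: each coordinate contributes `√3 ≤ exp (2 / 3)`, because `3 ≤
1 + 4/3 + (4/3)² / 2 ≤ exp (4 / 3)`. -/
theorem gaussPi_real_lt_sum_sq_le {ι : Type*} [Fintype ι] (x : ℝ) :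
    (gaussPi ι).real {w | x < ∑ i, w i ^ 2}
      ≤ Real.exp (-(x / 3) + 2 * Fintype.card ι / 3) := by
  have h3 : (√(1 - 2 * (1 / 3 : ℝ)))⁻¹ ≤ Real.exp (2 / 3) := by
    rw [← Real.sqrt_inv, Real.sqrt_le_left (Real.exp_pos _).le, ← Real.exp_nat_mul]
    have := Real.quadratic_le_exp_of_nonneg (x := ((2 : ℕ) : ℝ) * (2 / 3)) (by norm_num)
    norm_num at this ⊢
    linarith
  refine (measureReal_mono (fun w hw => ?_) (measure_ne_top _ _)).trans
    ((gaussPi_real_le_sum_mul_sq (ι := ι) (μ := fun _ => 1 / 3) (by norm_num) (x / 3)).trans ?_)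
  · change x / 3 ≤ _
    rw [← Finset.mul_sum]
    have : x < ∑ i, w i ^ 2 := hw
    linarith
  · rw [Real.exp_add, Finset.prod_const, Finset.card_univ]
    refine mul_le_mul_of_nonneg_left ((pow_le_pow_left₀ (by positivity) h3 _).trans_eq ?_)
      (Real.exp_pos _).le
    rw [← Real.exp_nat_mul]
    congr 1
    ring

/-- The left side is `(1 + l / √d) ^ (d / 2)`, and `1 + x ≤ exp x`. -/
theorem prod_inv_sqrt_le_exp {l : ℝ} (hl : 0 < l) {d : ℕ} (hd : 0 < d) :
    ((√(1 - 2 * (l / (2 * (l + √d)))))⁻¹) ^ d ≤ Real.exp (l * √d / 2) := by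
  have hs : 0 < √(d : ℝ) := Real.sqrt_pos.2 (by exact_mod_cast hd)
  have e : (1 - 2 * (l / (2 * (l + √d))))⁻¹ = l / √d + 1 := by
    have : (1 - 2 * (l / (2 * (l + √d)))) = √d / (l + √d) := by field_simp; ring
    rw [this]
    field_simp
  have h1 : (√(1 - 2 * (l / (2 * (l + √d)))))⁻¹ ≤ Real.exp (l / √d / 2) := by
    rw [← Real.sqrt_inv, e, Real.sqrt_le_left (Real.exp_pos _).le, ← Real.exp_nat_mul]
    refine (Real.add_one_le_exp _).trans_eq ?_
    congr 1
    push_cast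
    ring
  refine (pow_le_pow_left₀ (by positivity) h1 d).trans_eq ?_
  rw [← Real.exp_nat_mul]
  congr 1
  nth_rewrite 1 [← Real.mul_self_sqrt (Nat.cast_nonneg d)]
  field_simp

/-- The sum of the Euclidean norms of two independent standard Gaussian vectors concentrates. -/
theorem gaussPi_real_le_norm_add_norm {q p : ℕ} (hq : 0 < q) (hp : 0 < p) {t : ℝ} (ht : 0 ≤ t) :
    (gaussPi (Fin q ⊕ Fin p)).real {w | √p + √q + t
      ≤ √(∑ l, w (Sum.inl l) ^ 2) + √(∑ j, w (Sum.inr j) ^ 2)} ≤ Real.exp (-(t ^ 2 / 4)) := by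
  rcases ht.eq_or_lt with rfl | ht
  · simp
  -- The final exponent is `l² - l t`, which is smallest at `l = t / 2`.
  set l := t / 2 with hl
  have hl0 : 0 < l := by positivity
  -- The norm is replaced by its square through `√r ≤ r / (2 a) + a / 2`, with equality at `√r = a`.
  -- The choice `a = l + √d` keeps the coefficient of `r` below 1/2.
  have hpt : ∀ (d : ℕ) (r : ℝ), 0 ≤ r → l * √r ≤ l / (2 * (l + √d)) * r + l * (l + √d) / 2 := by
    intro d r hr
    have ha : 0 < l + √d := by positivity
    have : l / (2 * (l + √d)) * r + l * (l + √d) / 2 - l * √r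
        = l / (2 * (l + √d)) * (√r - (l + √d)) ^ 2 := by
      nth_rewrite 1 [← Real.mul_self_sqrt hr]
      field_simp
      ring
    have h2 : 0 ≤ l / (2 * (l + √d)) * (√r - (l + √d)) ^ 2 := by positivity
    linarith
  have hμ : ∀ d : ℕ, 0 < d → l / (2 * (l + √d)) < 1 / 2 := fun d hd => by
    have hs : 0 < √(d : ℝ) := Real.sqrt_pos.2 (by exact_mod_cast hd)
    rw [div_lt_div_iff₀ (by positivity) (by norm_num)]
    linarith
  have key := gaussPi_real_le_sum_mul_sq (ι := Fin q ⊕ Fin p)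
    (μ := Sum.elim (fun _ => l / (2 * (l + √q))) fun _ => l / (2 * (l + √p)))
    (by rintro (i | i) <;> simpa using hμ _ ‹_›)
    (l * (√p + √q + t) - l * (l + √q) / 2 - l * (l + √p) / 2)
  refine (measureReal_mono (fun w hw => ?_) (measure_ne_top _ _)).trans (key.trans ?_)
  · have hw' : √p + √q + t ≤ √(∑ l, w (Sum.inl l) ^ 2) + √(∑ j, w (Sum.inr j) ^ 2) := hw
    rw [Set.mem_ofPred_eq]
    simp only [Fintype.sum_sum_type, Sum.elim_inl, Sum.elim_inr, ← Finset.mul_sum]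
    have h1 := hpt q (∑ l, w (Sum.inl l) ^ 2) (Finset.sum_nonneg fun _ _ => sq_nonneg _)
    have h2 := hpt p (∑ j, w (Sum.inr j) ^ 2) (Finset.sum_nonneg fun _ _ => sq_nonneg _)
    have h3 := mul_le_mul_of_nonneg_left hw' hl0.le
    linarith
  · simp only [Fintype.prod_sum_type, Sum.elim_inl, Sum.elim_inr, Finset.prod_const,
      Finset.card_univ, Fintype.card_fin]
    refine (mul_le_mul_of_nonneg_left (mul_le_mul (prod_inv_sqrt_le_exp hl0 hq)
      (prod_inv_sqrt_le_exp hl0 hp) (by positivity) (Real.exp_pos _).le)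
      (Real.exp_pos _).le).trans_eq ?_
    rw [← Real.exp_add, ← Real.exp_add]
    congr 1
    rw [hl]
    ring

/-! ### Tails of one Gaussian variable -/

/-- Mills' bound for the tail of the standard Gaussian distribution. -/
theorem gaussianReal_real_Ioi_le {y : ℝ} (hy : 0 < y) :
    (gaussianReal 0 1).real (Set.Ioi y) ≤ gaussianPDFReal 0 1 y / y := by
  have hi := integrable_id_mul_gaussianPDFReal
  have lim : Filter.Tendsto (gaussianPDFReal 0 1) Filter.atTop (nhds 0) :=
    tendsto_zero_of_hasDerivAt_of_integrableOn_Ioi (a := y)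
      (fun x _ => hasDerivAt_gaussianPDFReal_std x) hi.neg.integrableOn
      (integrable_gaussianPDFReal 0 1).integrableOn
  have h1 : ∫ x in Set.Ioi y, gaussianPDFReal 0 1 x * x = gaussianPDFReal 0 1 y := by
    have := integral_Ioi_of_hasDerivAt_of_tendsto' (a := y)
      (fun x _ => (hasDerivAt_gaussianPDFReal_std x).fun_neg) (by simpa using hi.integrableOn)
      lim.neg
    simpa using this
  rw [measureReal_def, gaussianReal_apply_eq_integral _ one_ne_zero, ENNReal.toReal_ofReal
    (integral_nonneg fun x => gaussianPDFReal_nonneg _ _ _), le_div_iff₀ hy, ← h1,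
    ← integral_mul_const]
  refine setIntegral_mono_on ((integrable_gaussianPDFReal 0 1).mul_const y).integrableOn
    hi.integrableOn measurableSet_Ioi fun x hx => ?_
  exact mul_le_mul_of_nonneg_left (le_of_lt hx) (gaussianPDFReal_nonneg _ _ _)

theorem gaussianReal_map_neg_std : (gaussianReal 0 1).map (fun x => -x) = gaussianReal 0 1 := by
  rw [gaussianReal_map_neg, neg_zero]

theorem gaussianReal_real_lt_abs_le {y : ℝ} (hy : 0 < y) :
    (gaussianReal 0 1).real {x | y < |x|} ≤ √(2 / Real.pi) / y * Real.exp (-(y ^ 2 / 2)) := by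
  have hneg : (gaussianReal 0 1).real (Set.Iio (-y)) = (gaussianReal 0 1).real (Set.Ioi y) := by
    conv_rhs => rw [← gaussianReal_map_neg_std]
    rw [map_measureReal_apply measurable_neg measurableSet_Ioi]
    simp
  have hset : {x : ℝ | y < |x|} = Set.Ioi y ∪ Set.Iio (-y) := by
    ext x
    simp [lt_abs, lt_neg]
  rw [hset]
  refine (measureReal_union_le _ _).trans ?_
  rw [hneg]
  have h := gaussianReal_real_Ioi_le hy
  refine (add_le_add h h).trans_eq ?_
  have e : √(2 / Real.pi) = 2 * (√(2 * Real.pi))⁻¹ := by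
    rw [← Real.sqrt_inv, show (2 : ℝ) / Real.pi = 2 ^ 2 * (2 * Real.pi)⁻¹ by
      field_simp, Real.sqrt_mul (by norm_num), Real.sqrt_sq (by norm_num)]
  rw [e, gaussianPDFReal]
  simp only [NNReal.coe_one, mul_one, sub_zero, neg_div]
  ring

theorem one_half_le_gaussianReal_real_Ici : 1 / 2 ≤ (gaussianReal 0 1).real (Set.Ici 0) := by
  have hneg : (gaussianReal 0 1).real (Set.Iic 0) = (gaussianReal 0 1).real (Set.Ici 0) := by
    conv_rhs => rw [← gaussianReal_map_neg_std]
    rw [map_measureReal_apply measurable_neg measurableSet_Ici]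
    simp
  have := measureReal_union_le (μ := gaussianReal 0 1) (Set.Iic (0 : ℝ)) (Set.Ici 0)
  rw [Set.Iic_union_Ici, probReal_univ, hneg] at this
  linarith

/-! ### The operator norm of a standard Gaussian matrix -/

theorem exists_unit_lt_of_lt_opNorm {q p : ℕ} {M : Matrix (Fin q) (Fin p) ℝ} {τ : ℝ} (hτ : 0 ≤ τ)
    (h : τ < opNorm M) : ∃ (u : EuclideanSpace ℝ (Fin q)) (v : EuclideanSpace ℝ (Fin p)),
      ‖u‖ = 1 ∧ ‖v‖ = 1 ∧ τ < u.ofLp ⬝ᵥ M *ᵥ v.ofLp := by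
  rw [opNorm, Matrix.l2_opNorm_def] at h
  set L := (Matrix.toEuclideanLin (𝕜 := ℝ)).trans LinearMap.toContinuousLinearMap M with hL
  obtain ⟨v, hv⟩ : ∃ v, τ * ‖v‖ < ‖L v‖ := by
    by_contra! hc
    exact absurd (L.opNorm_le_bound hτ hc) (not_le.2 h)
  have hLv : 0 < ‖L v‖ := lt_of_le_of_lt (by positivity) hv
  have hv0 : 0 < ‖v‖ := by
    rw [norm_pos_iff]
    rintro rfl
    simp at hLv
  refine ⟨‖L v‖⁻¹ • L v, ‖v‖⁻¹ • v, ?_, ?_, ?_⟩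
  · rw [norm_smul, norm_inv, norm_norm, inv_mul_cancel₀ hLv.ne']
  · rw [norm_smul, norm_inv, norm_norm, inv_mul_cancel₀ hv0.ne']
  · have e : M *ᵥ v.ofLp = (L v).ofLp := rfl
    have e2 : (L v).ofLp ⬝ᵥ (L v).ofLp = ‖L v‖ ^ 2 := by
      rw [EuclideanSpace.real_norm_sq_eq, dotProduct]
      exact Finset.sum_congr rfl fun i _ => (sq _).symm
    rw [WithLp.ofLp_smul, WithLp.ofLp_smul, Matrix.mulVec_smul, smul_dotProduct, dotProduct_smul,
      e, e2, smul_eq_mul, smul_eq_mul]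
    rw [← lt_div_iff₀ hv0] at hv
    refine hv.trans_eq ?_
    field_simp

theorem dotProduct_le_sqrt_sum_sq {ι : Type*} [Fintype ι] {u : EuclideanSpace ℝ ι} (hu : ‖u‖ = 1)
    (g : ι → ℝ) : u.ofLp ⬝ᵥ g ≤ √(∑ i, g i ^ 2) := by
  have h := real_inner_le_norm (WithLp.toLp 2 g) u
  rw [hu, mul_one, EuclideanSpace.norm_eq, EuclideanSpace.inner_eq_star_dotProduct, star_trivial]
    at h
  simpa using h

theorem dotProduct_self_of_norm_eq_one {ι : Type*} [Fintype ι] {u : EuclideanSpace ℝ ι}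
    (hu : ‖u‖ = 1) : u.ofLp ⬝ᵥ u.ofLp = 1 := by
  have h := real_inner_self_eq_norm_sq u
  rwa [hu, one_pow, EuclideanSpace.inner_eq_star_dotProduct, star_trivial] at h

theorem dotProduct_le_one {ι : Type*} [Fintype ι] {u v : EuclideanSpace ℝ ι}
    (hu : ‖u‖ = 1) (hv : ‖v‖ = 1) : u.ofLp ⬝ᵥ v.ofLp ≤ 1 := by
  have h := real_inner_le_norm v u
  rwa [hu, hv, mul_one, EuclideanSpace.inner_eq_star_dotProduct, star_trivial] at h

theorem outer_dotProduct_outer {α β : Type*} [Fintype α] [Fintype β] (u u' : α → ℝ)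
    (v v' : β → ℝ) : (fun z : α × β => u z.1 * v z.2) ⬝ᵥ (fun z => u' z.1 * v' z.2)
      = u ⬝ᵥ u' * v ⬝ᵥ v' := by
  simp only [dotProduct, Fintype.sum_prod_type, Finset.sum_mul_sum]
  exact Finset.sum_congr rfl fun _ _ => Finset.sum_congr rfl fun _ _ => by ring

/-- The maximum of a Gaussian bilinear form plus an independent Gaussian variable is dominated by
the maximum of the sum of two Gaussian linear forms. -/
theorem gaussPi_real_bilinear_add_le {q p N : ℕ} (hq : 0 < q) (hp : 0 < p) {t : ℝ} (ht : 0 ≤ t)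
    (u : Fin N → EuclideanSpace ℝ (Fin q)) (v : Fin N → EuclideanSpace ℝ (Fin p))
    (hu : ∀ k, ‖u k‖ = 1) (hv : ∀ k, ‖v k‖ = 1) :
    (gaussPi ((Fin q × Fin p) ⊕ Unit)).real {w | ∃ k, √p + √q + t
      < (u k).ofLp ⬝ᵥ (Matrix.of fun l j => w (Sum.inl (l, j))) *ᵥ (v k).ofLp + w (Sum.inr ())}
      ≤ Real.exp (-(t ^ 2 / 4)) := by
  have key := slepian (√p + √q + t) (K := Fin N)
    (a := fun k => Sum.elim (fun z : Fin q × Fin p => u k z.1 * v k z.2) (fun _ : Unit => 1))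
    (b := fun k => Sum.elim (u k).ofLp (v k).ofLp) ?_ ?_
  · refine le_trans (le_of_eq ?_) (key.trans (le_trans (measureReal_mono (fun w hw => ?_)
      (measure_ne_top _ _)) (gaussPi_real_le_norm_add_norm hq hp ht)))
    · congr 1
      ext w
      refine exists_congr fun k => ?_
      have : (Sum.elim (fun z : Fin q × Fin p => u k z.1 * v k z.2) fun _ : Unit => 1) ⬝ᵥ w
          = (u k).ofLp ⬝ᵥ (Matrix.of fun l j => w (Sum.inl (l, j))) *ᵥ (v k).ofLp
            + w (Sum.inr ()) := by
        simp only [dotProduct, Matrix.mulVec, Fintype.sum_sum_type, Sum.elim_inl, Sum.elim_inr,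
          Fintype.sum_prod_type, Finset.mul_sum, Matrix.of_apply, Finset.univ_unique,
          Finset.sum_singleton, one_mul]
        congr 1
        exact Finset.sum_congr rfl fun _ _ => Finset.sum_congr rfl fun _ _ => by ring
      rw [this]
    · obtain ⟨k, hk⟩ := hw
      refine hk.trans ?_
      have e : Sum.elim (u k).ofLp (v k).ofLp ⬝ᵥ w
          = (u k).ofLp ⬝ᵥ (fun l => w (Sum.inl l)) + (v k).ofLp ⬝ᵥ (fun j => w (Sum.inr j)) := by
        simp [dotProduct]
      rw [e]
      exact add_le_add (dotProduct_le_sqrt_sum_sq (hu k) _) (dotProduct_le_sqrt_sum_sq (hv k) _)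
  · intro k
    simp [sumElim_dotProduct_sumElim, outer_dotProduct_outer,
      dotProduct_self_of_norm_eq_one (hu k), dotProduct_self_of_norm_eq_one (hv k)]
  · intro k l
    simp only [sumElim_dotProduct_sumElim, outer_dotProduct_outer]
    have h1 := dotProduct_le_one (hu k) (hu l)
    have h2 := dotProduct_le_one (hv k) (hv l)
    have h3 : (fun _ : Unit => (1 : ℝ)) ⬝ᵥ (fun _ : Unit => (1 : ℝ)) = 1 := by simp [dotProduct]
    rw [h3]
    -- With `x`, `y` the two inner products, the claim `x + y ≤ x y + 1` is `(1 - x)(1 - y) ≥ 0`.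
    nlinarith

/-- The comparison for finitely many pairs of unit vectors passes to a dense sequence by monotone
limits, then to all pairs by continuity. The auxiliary variable is removed on the half space where
it is non-negative. -/
theorem gaussPi_real_lt_opNorm_le {q p : ℕ} (hq : 0 < q) (hp : 0 < p) {t : ℝ} (ht : 0 ≤ t) :
    (gaussPi (Fin q × Fin p)).real {w | √p + √q + t < opNorm (Matrix.of fun l j => w (l, j))}
      ≤ 2 * Real.exp (-(t ^ 2 / 4)) := by
  set τ := √p + √q + t with hτ
  have hτ0 : 0 ≤ τ := by positivity
  have : Nonempty (Fin q) := ⟨⟨0, hq⟩⟩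
  have : Nonempty (Fin p) := ⟨⟨0, hp⟩⟩
  have : Nonempty (Metric.sphere (0 : EuclideanSpace ℝ (Fin q)) 1) :=
    (NormedSpace.sphere_nonempty.2 zero_le_one).to_subtype
  have : Nonempty (Metric.sphere (0 : EuclideanSpace ℝ (Fin p)) 1) :=
    (NormedSpace.sphere_nonempty.2 zero_le_one).to_subtype
  let S := Metric.sphere (0 : EuclideanSpace ℝ (Fin q)) 1 ×
    Metric.sphere (0 : EuclideanSpace ℝ (Fin p)) 1
  let d : ℕ → S := TopologicalSpace.denseSeq S
  let form : S → ((Fin q × Fin p) ⊕ Unit → ℝ) → ℝ := fun s w =>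
    s.1.1.ofLp ⬝ᵥ (Matrix.of fun l j => w (Sum.inl (l, j))) *ᵥ s.2.1.ofLp + w (Sum.inr ())
  let A : ℕ → Set ((Fin q × Fin p) ⊕ Unit → ℝ) := fun N => {w | ∃ k : Fin N, τ < form (d k) w}
  have hAmono : Monotone A := fun N N' h w ⟨k, hk⟩ => ⟨Fin.castLE h k, hk⟩
  have hA : (gaussPi ((Fin q × Fin p) ⊕ Unit)).real (⋃ N, A N) ≤ Real.exp (-(t ^ 2 / 4)) := by
    rw [measureReal_def, hAmono.measure_iUnion]
    refine ENNReal.toReal_le_of_le_ofReal (Real.exp_pos _).le (iSup_le fun N => ?_)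
    rw [← ofReal_measureReal]
    exact ENNReal.ofReal_le_ofReal (gaussPi_real_bilinear_add_le hq hp ht
      (fun k : Fin N => (d k).1.1) (fun k => (d k).2.1) (fun k => by simp) fun k => by simp)
  have hsub : MeasurableEquiv.sumPiEquivProdPi (fun _ : (Fin q × Fin p) ⊕ Unit => ℝ) ⁻¹'
      ({w | τ < opNorm (Matrix.of fun l j => w (l, j))} ×ˢ {w | w () ∈ Set.Ici 0}) ⊆ ⋃ N, A N := by
    rintro w ⟨h1, h2⟩
    have h2' : 0 ≤ w (Sum.inr ()) := h2
    obtain ⟨u, v, hu, hv, huv⟩ := exists_unit_lt_of_lt_opNorm hτ0 h1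
    have hcont' : Continuous fun s : EuclideanSpace ℝ (Fin q) × EuclideanSpace ℝ (Fin p) =>
        s.1.ofLp ⬝ᵥ (Matrix.of fun l j => w (Sum.inl (l, j))) *ᵥ s.2.ofLp + w (Sum.inr ()) := by
      simp only [dotProduct, Matrix.mulVec]
      fun_prop
    have hcont : Continuous fun s => form s w :=
      hcont'.comp ((continuous_subtype_val.comp continuous_fst).prodMk
        (continuous_subtype_val.comp continuous_snd))
    obtain ⟨n, hn⟩ := (TopologicalSpace.denseRange_denseSeq S).exists_mem_open
      (isOpen_lt continuous_const hcont : IsOpen {s | τ < form s w})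
      ⟨(⟨u, by simpa using hu⟩, ⟨v, by simpa using hv⟩), lt_add_of_lt_of_nonneg huv h2'⟩
    exact Set.mem_iUnion.2 ⟨n + 1, ⟨n, n.lt_succ_self⟩, hn⟩
  have hprod := (measureReal_mono hsub (measure_ne_top (gaussPi _) _)).trans hA
  -- The matrix and the auxiliary variable are independent, so the probability factors.
  rw [measureReal_def, (measurePreserving_sumPiEquivProdPi
    fun _ : (Fin q × Fin p) ⊕ Unit => gaussianReal 0 1).measure_preimage_equiv,
    Measure.prod_prod, ENNReal.toReal_mul] at hprod
  have hγ : ((Measure.pi fun _ : Unit => gaussianReal 0 1) {w | w () ∈ Set.Ici 0}).toReal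
      = (gaussianReal 0 1).real (Set.Ici 0) :=
    (measurePreserving_eval (fun _ : Unit => gaussianReal 0 1) ()).measureReal_preimage
      measurableSet_Ici.nullMeasurableSet
  rw [hγ] at hprod
  have h0 := mul_le_mul_of_nonneg_left one_half_le_gaussianReal_real_Ici
    (measureReal_nonneg (μ := gaussPi (Fin q × Fin p))
      (s := {w | τ < opNorm (Matrix.of fun l j => w (l, j))}))
  rw [measureReal_def] at h0 ⊢
  linarith

/-! ### Linear images of the noise -/

/-- Linear combinations of independent isotropic Gaussian vectors whose coefficients are
orthonormal are independent standard Gaussian variables. -/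
theorem map_sum_dotProduct_eq_gaussPi {Ω τ κ ι : Type*} [MeasurableSpace Ω] {P : Measure Ω}
    [IsProbabilityMeasure P] [Fintype τ] [Fintype κ] [DecidableEq κ] [Fintype ι] [DecidableEq ι]
    {Z : τ → Ω → κ → ℝ} {v : ℝ} (hv : 0 ≤ v) (hind : iIndepFun Z P)
    (hlaw : ∀ t, HasLaw (fun ω => WithLp.toLp 2 (Z t ω))
      (multivariateGaussian 0 (v • (1 : Matrix κ κ ℝ))) P)
    {a : τ → ι → κ → ℝ}
    (ha : ∀ i i', v * ∑ t, a t i ⬝ᵥ a t i' = if i = i' then 1 else 0) :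
    AEMeasurable (fun ω i => ∑ t, a t i ⬝ᵥ Z t ω) P ∧
    P.map (fun ω i => ∑ t, a t i ⬝ᵥ Z t ω) = gaussPi ι := by
  have hZ : ∀ t, AEMeasurable (Z t) P := fun t =>
    (WithLp.measurable_ofLp 2 (κ → ℝ)).comp_aemeasurable (hlaw t).aemeasurable
  let f : τ → (κ → ℝ) → EuclideanSpace ℝ ι := fun t z => WithLp.toLp 2 fun i => a t i ⬝ᵥ z
  have hf : ∀ t, Measurable (f t) := fun t =>
    (WithLp.measurable_toLp 2 (ι → ℝ)).comp
      (measurable_pi_lambda _ fun i => (continuous_const_dotProduct (a t i)).measurable)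
  have hG : ∀ t, AEMeasurable (fun ω => f t (Z t ω)) P := fun t => (hf t).comp_aemeasurable (hZ t)
  have hS : (v • (1 : Matrix κ κ ℝ)).PosSemidef := Matrix.PosSemidef.one.smul hv
  have hchar : ∀ t x, charFun (P.map fun ω => f t (Z t ω)) x
      = Complex.exp (-(v * ∑ k, (∑ i, x i * a t i k) ^ 2 : ℝ) / 2) := by
    intro t x
    -- A linear map moves to the argument of the characteristic function as its adjoint.
    have h1 : charFun (P.map fun ω => f t (Z t ω)) x
        = charFun (P.map fun ω => WithLp.toLp 2 (Z t ω))
          (WithLp.toLp 2 fun k => ∑ i, x i * a t i k) := by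
      rw [charFun_apply, charFun_apply, integral_map (hG t) (by fun_prop),
        integral_map (hlaw t).aemeasurable (by fun_prop)]
      refine integral_congr_ae (ae_of_all _ fun ω => ?_)
      simp only [f, EuclideanSpace.inner_eq_star_dotProduct, star_trivial]
      congr 3
      simp only [dotProduct, Finset.mul_sum, Finset.sum_mul]
      rw [Finset.sum_comm]
      exact Finset.sum_congr rfl fun _ _ => Finset.sum_congr rfl fun _ _ => by ring
    rw [h1, (hlaw t).map_eq, charFun_multivariateGaussian hS]
    congr 1
    simp only [dotProduct, Matrix.smul_mulVec, sq, neg_div, inner_zero_right, Complex.ofReal_zero,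
      zero_mul, zero_sub, Matrix.one_mulVec, Pi.smul_apply, smul_eq_mul]
    rw [Finset.mul_sum]
    congr 4
    exact funext fun _ => by ring
  have hsum : P.map (∑ t, fun ω => f t (Z t ω)) = stdGaussian (EuclideanSpace ℝ ι) := by
    have : IsProbabilityMeasure (P.map (∑ t, fun ω => f t (Z t ω))) :=
      Measure.isProbabilityMeasure_map (Finset.aemeasurable_sum _ fun t _ => hG t)
    refine Measure.ext_of_charFun (funext fun x => ?_)
    rw [(hind.comp f hf).charFun_map_sum_eq_prod hG, charFun_stdGaussian, Finset.prod_apply]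
    refine (Finset.prod_congr rfl fun t _ => hchar t x).trans ?_
    rw [← Complex.exp_sum]
    congr 1
    rw [← Finset.sum_div, Finset.sum_neg_distrib, ← Complex.ofReal_sum, ← Complex.ofReal_pow]
    congr 3
    rw [EuclideanSpace.real_norm_sq_eq]
    -- Expanded as a quadratic form in `x`, the exponents sum over `t` to `‖x‖²` by orthonormality.
    have e : ∀ t, v * ∑ k, (∑ i, x i * a t i k) ^ 2
        = ∑ i, ∑ i', x i * x i' * (v * a t i ⬝ᵥ a t i') := fun t => by
      simp only [sq, Finset.sum_mul_sum, dotProduct]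
      simp only [Finset.mul_sum]
      rw [Finset.sum_comm]
      refine Finset.sum_congr rfl fun i _ => ?_
      rw [Finset.sum_comm]
      exact Finset.sum_congr rfl fun _ _ => Finset.sum_congr rfl fun _ _ => by ring
    simp_rw [e]
    rw [Finset.sum_comm]
    refine Finset.sum_congr rfl fun i _ => ?_
    rw [Finset.sum_comm]
    simp_rw [← Finset.mul_sum, ha]
    simp [sq]
  have hofLp : (fun ω i => ∑ t, a t i ⬝ᵥ Z t ω)
      = WithLp.ofLp ∘ (∑ t, fun ω => f t (Z t ω) : Ω → EuclideanSpace ℝ ι) := by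
    funext ω i
    simp [f, Finset.sum_apply, WithLp.ofLp_sum]
  have hm : AEMeasurable (∑ t, fun ω => f t (Z t ω)) P := Finset.aemeasurable_sum _ fun t _ => hG t
  rw [hofLp]
  refine ⟨(WithLp.measurable_ofLp 2 (ι → ℝ)).comp_aemeasurable hm, ?_⟩
  rw [← AEMeasurable.map_map_of_aemeasurable (WithLp.measurable_ofLp 2 (ι → ℝ)).aemeasurable hm,
    hsum, ← map_pi_eq_stdGaussian, Measure.map_map (WithLp.measurable_ofLp 2 (ι → ℝ))
      (WithLp.measurable_toLp 2 (ι → ℝ))]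
  exact Measure.map_id

/-! ### The plug-in error as a linear function of the noise -/

section

variable {T n p m q : ℕ}

theorem stackVec_mul_add (A : Matrix (Fin n) (Fin m) ℝ) (B : Matrix (Fin q) (Fin p) ℝ)
    (X : Fin T → Matrix (Fin m) (Fin q) ℝ) (E : Fin T → Matrix (Fin n) (Fin p) ℝ) :
    stackVec (fun t => A * X t * B + E t) = stackVec X * (B ⊗ₖ Aᵀ) + stackVec E := by
  ext t ⟨j, i⟩
  simp only [stackVec, Matrix.of_apply, Matrix.vec, Matrix.add_apply, Matrix.mul_apply,
    Fintype.sum_prod_type, Matrix.kroneckerMap_apply, Matrix.transpose_apply, Finset.sum_mul]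
  congr 1
  exact Finset.sum_congr rfl fun _ _ => Finset.sum_congr rfl fun _ _ => by ring

theorem transpose_stackVec_mul_stackVec (hT : 0 < T) {X : Fin T → Matrix (Fin m) (Fin q) ℝ}
    (hX : (1 / (T : ℝ)) • ((stackVec X)ᵀ * stackVec X) = 1) :
    (stackVec X)ᵀ * stackVec X = (T : ℝ) • 1 := by
  have hT' : (T : ℝ) ≠ 0 := by exact_mod_cast hT.ne'
  rw [← hX, smul_smul, mul_one_div_cancel hT', one_smul]

theorem cHat_eq (hT : 0 < T) {X : Fin T → Matrix (Fin m) (Fin q) ℝ}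
    (hX : (1 / (T : ℝ)) • ((stackVec X)ᵀ * stackVec X) = 1) (A : Matrix (Fin n) (Fin m) ℝ)
    (B : Matrix (Fin q) (Fin p) ℝ) (E : Fin T → Matrix (Fin n) (Fin p) ℝ) :
    cHat X (fun t => A * X t * B + E t)
      = B ⊗ₖ Aᵀ + (T : ℝ)⁻¹ • ((stackVec X)ᵀ * stackVec E) := by
  have hT' : (T : ℝ) ≠ 0 := by exact_mod_cast hT.ne'
  have hXX := transpose_stackVec_mul_stackVec hT hX
  have hinv : ((T : ℝ) • (1 : Matrix (Fin q × Fin m) (Fin q × Fin m) ℝ))⁻¹ = (T : ℝ)⁻¹ • 1 := by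
    refine Matrix.inv_eq_right_inv ?_
    rw [Matrix.smul_mul, Matrix.one_mul, smul_smul, mul_inv_cancel₀ hT', one_smul]
  rw [cHat, stackVec_mul_add, hXX, hinv, Matrix.mul_add, Matrix.smul_mul, Matrix.one_mul,
    Matrix.smul_mul, Matrix.smul_mul, ← Matrix.mul_assoc, hXX, Matrix.smul_mul, Matrix.one_mul,
    smul_smul, inv_mul_cancel₀ hT', one_smul]

/-- The error of the plug-in estimator is a linear function of the noise. -/
theorem bHat_sub_apply (hn : 0 < n) (hT : 0 < T) {A : Matrix (Fin n) (Fin m) ℝ}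
    (hA : ∀ i, ∑ k, A i k = 1) {X : Fin T → Matrix (Fin m) (Fin q) ℝ}
    (hX : (1 / (T : ℝ)) • ((stackVec X)ᵀ * stackVec X) = 1) (B : Matrix (Fin q) (Fin p) ℝ)
    (E : Fin T → Matrix (Fin n) (Fin p) ℝ) (l : Fin q) (j : Fin p) :
    (bHat X (fun t => A * X t * B + E t) - B) l j
      = (n * T : ℝ)⁻¹ * ∑ t, (∑ k, X t k l) * ∑ i, E t i j := by
  have hn' : (n : ℝ) ≠ 0 := by exact_mod_cast hn.ne'
  simp only [Matrix.sub_apply, bHat, Matrix.of_apply, cHat_eq hT hX, Matrix.add_apply,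
    Matrix.kroneckerMap_apply, Matrix.transpose_apply, Matrix.smul_apply, smul_eq_mul,
    Finset.sum_add_distrib, ← Finset.mul_sum, hA]
  have e : ∑ i, ∑ k, ((stackVec X)ᵀ * stackVec E) (l, k) (j, i)
      = ∑ t, (∑ k, X t k l) * ∑ i, E t i j := by
    simp only [Matrix.mul_apply, Matrix.transpose_apply, stackVec, Matrix.of_apply, Matrix.vec,
      Finset.sum_mul_sum]
    rw [Finset.sum_comm]
    simp_rw [Finset.sum_comm (t := (Finset.univ : Finset (Fin T)))]
  rw [e]
  simp only [Finset.sum_const, Finset.card_univ, Fintype.card_fin, nsmul_eq_mul, mul_one]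
  field_simp
  ring

/-- Of the `m²` products of design columns only the `m` diagonal ones survive, each equal to `T`.
This is the source of the factor `m` in the variance. -/
theorem sum_sum_mul_sum_eq (hT : 0 < T) {X : Fin T → Matrix (Fin m) (Fin q) ℝ}
    (hX : (1 / (T : ℝ)) • ((stackVec X)ᵀ * stackVec X) = 1) (l l' : Fin q) :
    ∑ t, (∑ k, X t k l) * ∑ k, X t k l' = if l = l' then (T * m : ℝ) else 0 := by
  have h : ∀ k k', ∑ t, X t k l * X t k' l' = if l = l' ∧ k = k' then (T : ℝ) else 0 := by
    intro k k'
    have := congrFun (congrFun (transpose_stackVec_mul_stackVec hT hX) (l, k)) (l', k')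
    simpa [Matrix.mul_apply, stackVec, Matrix.vec, Matrix.one_apply] using this
  simp_rw [Finset.sum_mul_sum]
  rw [Finset.sum_comm]
  simp_rw [Finset.sum_comm (s := (Finset.univ : Finset (Fin T))), h]
  split_ifs with hl <;> simp [hl, mul_comm]

end

/-! ### From the standardised error to the three tail bounds -/

theorem frobNorm_sq {q p : ℕ} (M : Matrix (Fin q) (Fin p) ℝ) :
    frobNorm M ^ 2 = ∑ z : Fin q × Fin p, M z.1 z.2 ^ 2 := by
  rw [frobNorm, Matrix.frobenius_norm_def, ← Real.sqrt_eq_rpow, Real.sq_sqrt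
    (Finset.sum_nonneg fun _ _ => Finset.sum_nonneg fun _ _ => by positivity),
    Fintype.sum_prod_type]
  simp

open scoped Matrix.Norms.L2Operator in
theorem opNorm_smul {q p : ℕ} {c : ℝ} (hc : 0 ≤ c) (M : Matrix (Fin q) (Fin p) ℝ) :
    opNorm (c • M) = c * opNorm M := by
  rw [opNorm, opNorm, norm_smul, Real.norm_of_nonneg hc]

open scoped Matrix.Norms.L2Operator in
theorem opNorm_zero {q p : ℕ} : opNorm (0 : Matrix (Fin q) (Fin p) ℝ) = 0 := norm_zero

theorem gaussPi_real_exists_lt_abs_le {ι : Type*} [Fintype ι] {y : ℝ} (hy : 0 < y) :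
    (gaussPi ι).real {w | ∃ i, y < |w i|}
      ≤ Fintype.card ι * (√(2 / Real.pi) / y * Real.exp (-(y ^ 2 / 2))) := by
  rw [Set.ofPred_exists]
  refine (measureReal_iUnion_fintype_le _).trans ?_
  rw [← nsmul_eq_mul]
  refine Finset.sum_le_card_nsmul _ _ _ fun i _ => ?_
  refine le_trans (le_of_eq ?_) (gaussianReal_real_lt_abs_le hy)
  exact (measurePreserving_eval (fun _ : ι => gaussianReal 0 1) i).measureReal_preimage
    (measurableSet_lt measurable_const measurable_abs).nullMeasurableSet

/-- The error of the plug-in estimator has independent centred Gaussian entries of variance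
`σ ^ 2 * m / (n * T)`. -/
theorem map_bHat_sub_eq_gaussPi {Ω : Type*} [MeasurableSpace Ω] {P : Measure Ω}
    [IsProbabilityMeasure P] {T n p m q : ℕ} (hn : 0 < n) (hm : 0 < m) (hT : 0 < T)
    {A : Matrix (Fin n) (Fin m) ℝ} (hA : ∀ i, ∑ k, A i k = 1) (B : Matrix (Fin q) (Fin p) ℝ)
    {X : Fin T → Matrix (Fin m) (Fin q) ℝ} {E : Fin T → Ω → Matrix (Fin n) (Fin p) ℝ}
    (hE_indep : iIndepFun (fun t ω => Matrix.vec (E t ω)) P) {σ : ℝ} (hσ : 0 < σ)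
    (hE_law : ∀ t, HasLaw (fun ω => WithLp.toLp 2 (Matrix.vec (E t ω)))
      (multivariateGaussian 0 (σ ^ 2 • (1 : Matrix (Fin p × Fin n) (Fin p × Fin n) ℝ))) P)
    (hX : (1 / (T : ℝ)) • ((stackVec X)ᵀ * stackVec X) = 1) :
    AEMeasurable (fun ω (z : Fin q × Fin p) =>
        (σ * √(m / (n * T)))⁻¹ * (bHat X (fun t => A * X t * B + E t ω) - B) z.1 z.2) P ∧
      P.map (fun ω (z : Fin q × Fin p) =>
        (σ * √(m / (n * T)))⁻¹ * (bHat X (fun t => A * X t * B + E t ω) - B) z.1 z.2)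
        = gaussPi (Fin q × Fin p) := by
  have hn' : (0 : ℝ) < n := by exact_mod_cast hn
  have hm' : (0 : ℝ) < m := by exact_mod_cast hm
  have hT' : (0 : ℝ) < T := by exact_mod_cast hT
  set r : ℝ := (σ * √(m / (n * T)))⁻¹ * (n * T : ℝ)⁻¹ with hr
  -- Unit variance: `n` counts the noise rows summed in each entry, and `T * m` is the squared
  -- length of a vector of design column sums.
  have hr2 : σ ^ 2 * (r ^ 2 * n * (T * m)) = 1 := by
    rw [hr, mul_pow, inv_pow, mul_pow, Real.sq_sqrt (by positivity)]
    field_simp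
  have key := map_sum_dotProduct_eq_gaussPi (sq_nonneg σ) hE_indep hE_law
    (a := fun t (z : Fin q × Fin p) (y : Fin p × Fin n) =>
      r * (∑ k, X t k z.1) * if z.2 = y.1 then 1 else 0) ?_
  · have heq : (fun ω (z : Fin q × Fin p) =>
        (σ * √(m / (n * T)))⁻¹ * (bHat X (fun t => A * X t * B + E t ω) - B) z.1 z.2)
        = fun ω z => ∑ t, (fun y : Fin p × Fin n =>
          r * (∑ k, X t k z.1) * if z.2 = y.1 then 1 else 0) ⬝ᵥ Matrix.vec (E t ω) := by
      funext ω z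
      rw [bHat_sub_apply hn hT hA hX, ← mul_assoc, ← hr, Finset.mul_sum]
      refine Finset.sum_congr rfl fun t _ => ?_
      simp only [dotProduct, Fintype.sum_prod_type, Matrix.vec]
      rw [Finset.sum_eq_single z.2 (fun j _ hj => by simp [hj.symm]) (by simp)]
      simp only [if_true, mul_one, ← Finset.mul_sum, mul_assoc]
    rw [heq]
    exact key
  · rintro ⟨l, j⟩ ⟨l', j'⟩
    have e : ∀ t, (fun y : Fin p × Fin n => r * (∑ k, X t k l) * if j = y.1 then 1 else 0) ⬝ᵥ
        (fun y : Fin p × Fin n => r * (∑ k, X t k l') * if j' = y.1 then 1 else 0)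
        = if j = j' then r ^ 2 * n * ((∑ k, X t k l) * ∑ k, X t k l') else 0 := fun t => by
      simp only [dotProduct, Fintype.sum_prod_type]
      rw [Finset.sum_eq_single j (fun i _ hi => by simp [hi.symm]) (by simp)]
      rcases eq_or_ne j j' with rfl | h
      · simp
        ring
      · simp [h, h.symm]
    simp only [e]
    by_cases hj : j = j'
    · simp only [hj, if_true, ← Finset.mul_sum, sum_sum_mul_sum_eq hT hX, Prod.mk.injEq, and_true,
        mul_ite, mul_zero, hr2]
    · simp [hj]

theorem mainTheorem1 {Ω : Type*} [MeasurableSpace Ω] (P : Measure Ω) [IsProbabilityMeasure P]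
    (T n p m q : ℕ) (hn : 0 < n)
    -- parameters of the model
    (A : Matrix (Fin n) (Fin m) ℝ) (B : Matrix (Fin q) (Fin p) ℝ)
    (hA_nonneg : ∀ i k, 0 ≤ A i k) (hA_row : ∀ i, ∑ k, |A i k| = 1)
    -- observations and noise
    (X : Fin T → Matrix (Fin m) (Fin q) ℝ)
    (Y E : Fin T → Ω → Matrix (Fin n) (Fin p) ℝ)
    (hY : ∀ t ω, Y t ω = A * X t * B + E t ω)
    (Sigma_r : Matrix (Fin n) (Fin n) ℝ) (Sigma_c : Matrix (Fin p) (Fin p) ℝ)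
    (hE_indep : iIndepFun (fun t ω => Matrix.vec (E t ω)) P)
    (hE_law : ∀ t, IsMatrixNormal (E t) 0 Sigma_r Sigma_c P)
    -- orthonormal design
    (hX : (1 / (T : ℝ)) • ((stackVec X)ᵀ * stackVec X) = 1)
    -- isotropic covariances
    (σ_r σ_c σ : ℝ) (hσ_r : 0 < σ_r) (hσ_c : 0 < σ_c) (hσ : σ = σ_r * σ_c)
    (hSigma_r : Sigma_r = σ_r ^ 2 • (1 : Matrix (Fin n) (Fin n) ℝ))
    (hSigma_c : Sigma_c = σ_c ^ 2 • (1 : Matrix (Fin p) (Fin p) ℝ))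
    (ε : ℝ) (hε : 0 < ε) :
    P.real {ω | ε < maxNorm (bHat X (fun t => Y t ω) - B)}
        ≤ (p * q * σ / ε) * √(2 * m / (T * n * Real.pi))
          * Real.exp (-(T * n * ε ^ 2 / (2 * m * σ ^ 2))) ∧
    (σ * √(m / (n * T)) * (√p + √q) ≤ ε →
      P.real {ω | ε < opNorm (bHat X (fun t => Y t ω) - B)}
        ≤ 2 * Real.exp (-(ε * √(n * T) / (2 * σ * √m) - (√p + √q) / 2) ^ 2)) ∧
    P.real {ω | ε < frobNorm (bHat X (fun t => Y t ω) - B) ^ 2}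
        ≤ 2 * Real.exp (-(T * n * ε / (3 * m * σ ^ 2)) + 2 * p * q / 3) := by
  have hσ0 : 0 < σ := hσ ▸ mul_pos hσ_r hσ_c
  have hA : ∀ i, ∑ k, A i k = 1 := fun i => by
    simpa only [abs_of_nonneg (hA_nonneg i _)] using hA_row i
  have hm : 0 < m := by
    rcases Nat.eq_zero_or_pos m with rfl | h
    · simpa using hA ⟨0, hn⟩
    · exact h
  -- Without entries all three norms are 0, the max norm as a supremum over the empty type.
  rcases isEmpty_or_nonempty (Fin q × Fin p) with he | hne
  · have h0 : ∀ M : Matrix (Fin q) (Fin p) ℝ, M = 0 := fun M => by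
      ext l j
      exact (he.false (l, j)).elim
    have h1 : ∀ M : Matrix (Fin q) (Fin p) ℝ, ¬ ε < maxNorm M := fun M => by
      rw [maxNorm, Real.iSup_of_isEmpty]
      exact hε.not_gt
    have h2 : ∀ M : Matrix (Fin q) (Fin p) ℝ, ¬ ε < opNorm M := fun M => by
      rw [h0 M, opNorm_zero]
      exact hε.not_gt
    have h3 : ∀ M : Matrix (Fin q) (Fin p) ℝ, ¬ ε < frobNorm M ^ 2 := fun M => by
      rw [frobNorm_sq, Finset.univ_eq_empty, Finset.sum_empty]
      exact hε.not_gt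
    simp only [h1, h2, h3, Set.ofPred_false, measureReal_empty]
    exact ⟨by positivity, fun _ => by positivity, by positivity⟩
  obtain ⟨l₀, j₀⟩ := id hne
  have hq : 0 < q := l₀.pos
  have hp : 0 < p := j₀.pos
  -- With `T = 0` the normalised Gram matrix would be 0 instead of the identity, which has an entry
  -- since `q` and `m` are positive.
  have hT : 0 < T := by
    rcases Nat.eq_zero_or_pos T with rfl | h
    · have := congrFun (congrFun hX (l₀, ⟨0, hm⟩)) (l₀, ⟨0, hm⟩)
      simp at this
    · exact h
  have hn' : (0 : ℝ) < n := by exact_mod_cast hn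
  have hm' : (0 : ℝ) < m := by exact_mod_cast hm
  have hT' : (0 : ℝ) < T := by exact_mod_cast hT
  have hlaw : ∀ t, HasLaw (fun ω => WithLp.toLp 2 (Matrix.vec (E t ω)))
      (multivariateGaussian 0 (σ ^ 2 • (1 : Matrix (Fin p × Fin n) (Fin p × Fin n) ℝ))) P := by
    intro t
    have h := hE_law t
    have e : (σ_c ^ 2 • (1 : Matrix (Fin p) (Fin p) ℝ)) ⊗ₖ
        (σ_r ^ 2 • (1 : Matrix (Fin n) (Fin n) ℝ))
        = σ ^ 2 • (1 : Matrix (Fin p × Fin n) (Fin p × Fin n) ℝ) := by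
      rw [Matrix.smul_kronecker, Matrix.kronecker_smul, Matrix.one_kronecker_one, smul_smul, hσ,
        mul_pow, mul_comm]
    rw [IsMatrixNormal, hSigma_r, hSigma_c, e] at h
    simpa using h
  obtain ⟨hDm, hD⟩ := map_bHat_sub_eq_gaussPi hn hm hT hA B hE_indep hσ0 hlaw hX
  simp only [hY]
  set s := σ * √(m / (n * T)) with hs
  have hs0 : 0 < s := by positivity
  have hs2 : s ^ 2 = σ ^ 2 * (m / (n * T)) := by
    rw [hs, mul_pow, Real.sq_sqrt (by positivity)]
  set M : Ω → Matrix (Fin q) (Fin p) ℝ := fun ω => bHat X (fun t => A * X t * B + E t ω) - B with hM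
  set D : Ω → Fin q × Fin p → ℝ := fun ω z => s⁻¹ * M ω z.1 z.2 with hDdef
  have hMD : ∀ ω, M ω = s • Matrix.of fun l j => D ω (l, j) := fun ω => by
    ext l j
    simp [hDdef, mul_inv_cancel_left₀ hs0.ne']
  -- Only an upper bound is needed, and it holds for every set, so no event has to be shown
  -- measurable.
  have hle : ∀ {S : Set Ω} (W : Set (Fin q × Fin p → ℝ)), (∀ ω ∈ S, D ω ∈ W) →
      P.real S ≤ (gaussPi (Fin q × Fin p)).real W := fun {S} W hSW => by
    refine (measureReal_mono (s₂ := D ⁻¹' W) hSW (measure_ne_top _ _)).trans ?_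
    rw [← hD]
    exact ENNReal.toReal_mono (by rw [hD]; exact measure_ne_top _ _) (Measure.le_map_apply hDm W)
  refine ⟨?_, fun hεs => ?_, ?_⟩
  · refine (hle {w | ∃ z, ε / s < |w z|} fun ω hω => ?_).trans
      ((gaussPi_real_exists_lt_abs_le (by positivity)).trans_eq ?_)
    · obtain ⟨z, hz⟩ := exists_lt_of_lt_ciSup (show ε < ⨆ z : Fin q × Fin p, |M ω z.1 z.2| from hω)
      refine ⟨z, ?_⟩
      rw [hDdef, abs_mul, abs_of_pos (inv_pos.2 hs0), div_eq_inv_mul]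
      exact mul_lt_mul_of_pos_left hz (inv_pos.2 hs0)
    · have e1 : √(2 * m / (T * n * Real.pi)) = √(2 / Real.pi) * √(m / (n * T)) := by
        rw [← Real.sqrt_mul (by positivity)]
        congr 1
        field_simp
      have e2 : (ε / s) ^ 2 / 2 = T * n * ε ^ 2 / (2 * m * σ ^ 2) := by
        rw [div_pow, hs2]
        field_simp
      rw [e1, e2, hs, Fintype.card_prod, Fintype.card_fin, Fintype.card_fin]
      push_cast
      field_simp
  -- The bound is applied with `t = ε / s - (√p + √q)`; the assumption on `ε` says `t ≥ 0`, and `t²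
  -- / 4` is the stated square.
  · have ht : 0 ≤ ε / s - (√p + √q) := by
      rw [sub_nonneg, le_div_iff₀ hs0, mul_comm]
      exact hεs
    refine (hle {w | √p + √q + (ε / s - (√p + √q)) < opNorm (Matrix.of fun l j => w (l, j))}
      fun ω hω => ?_).trans ((gaussPi_real_lt_opNorm_le hq hp ht).trans_eq ?_)
    · rw [Set.mem_ofPred_eq, add_sub_cancel, div_lt_iff₀' hs0, ← opNorm_smul hs0.le, ← hMD]
      exact hω
    · have e : ε * √(n * T) / (2 * σ * √m) = ε / s / 2 := by
        rw [hs, Real.sqrt_div hm'.le]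
        field_simp
      rw [e]
      congr 2
      ring
  · refine (hle {w | ε / s ^ 2 < ∑ z, w z ^ 2} fun ω hω => ?_).trans
      ((gaussPi_real_lt_sum_sq_le _).trans ?_)
    · have h : ε < frobNorm (M ω) ^ 2 := hω
      rw [frobNorm_sq] at h
      rw [Set.mem_ofPred_eq, div_lt_iff₀' (by positivity), Finset.mul_sum]
      refine h.trans_eq (Finset.sum_congr rfl fun z _ => ?_)
      rw [hDdef]
      field_simp
    · have e : -(ε / s ^ 2 / 3) + 2 * (Fintype.card (Fin q × Fin p) : ℝ) / 3
          = -(T * n * ε / (3 * m * σ ^ 2)) + 2 * p * q / 3 := by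
        rw [hs2, Fintype.card_prod, Fintype.card_fin, Fintype.card_fin]
        push_cast
        congr 1
        · field_simp
        · ring
      rw [e]
      -- Chernoff's bound holds without the factor 2 of the statement.
      linarith [Real.exp_pos (-(T * n * ε / (3 * m * σ ^ 2)) + 2 * p * q / 3)]
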